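/- Let $s>0$, and let $X_1,\dots,X_{n_1}$ and $Y_1,\dots,Y_{n_2}$ be real observations without ties between the two samples, i.e. $X_j\neq Y_k$ for all $j,k$. For Borel probability measures $G_1,G_2$ on $\mathbb{R}$, let $F_X\sim Dp(s,G_1)$ and $F_Y\sim Dp(s,G_2)$ be independent Dirichlet processes with strength $s$ and normalized base measures $G_1,G_2$ (a priori), let $X^{n_1}$ be an i.i.d. sample from $F_X$ and $Y^{n_2}$ an independent i.i.d. sample from $F_Y$, and let the posterior of $(F_X,F_Y)$ given $X^{n_1}=(X_1,\dots,X_{n_1})$, $Y^{n_2}=(Y_1,\dots,Y_{n_2})$ be taken in its usual version, under which $F_X$ and $F_Y$ are independent Dirichlet processes with unnormalized base measures $sG_1+\sum_{j}\delta_{X_j}$ and $sG_2+\sum_{k}\delta_{Y_k}$. Write $P(X\le Y)=\int F_X(y)\,dF_Y(y)$ (with $F_X$ also denoting the distribution function), and let $\overline{\mathcal P}[P(X\le Y)>c\mid X^{n_1},Y^{n_2}]$ be the supremum, over all probability measures $G_1,G_2$ on $\mathbb{R}$, of the posterior probability of the event $P(X\le Y)>c$. Let $(w_{i0},w_{i1},\dots,w_{in_i})\sim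 Dir(s,1,\dots,1)$ (with $n_i$ ones) for $i=1,2$, independent of each other, and put $$g=w_{10}w_{20}+w_{10}\sum_{j=1}^{n_2}w_{2j}+w_{20}\sum_{j=1}^{n_1}w_{1j}+\sum_{j=1}^{n_1}\sum_{k=1}^{n_2}w_{1j}w_{2k}\,I_{(X_j,\infty)}(Y_k).$$ Then, for every $c\in[0,1]$, $$\overline{\mathcal P}\big[P(X\le Y)>c\mid X^{n_1},Y^{n_2}\big]=P[g>c].$$ Moreover, let $W=[w_{10},\dots,w_{1n_1}]^T$, $V=[w_{20},\dots,w_{2n_2}]^T$, and let $A$ be the $(n_1+1)\times(n_2+1)$ matrix, with rows and columns numbered from $0$, with entries $a_{jk}=1$ if $j=0$ or $k=0$ and $a_{jk}=I_{(X_j,\infty)}(Y_k)$ otherwise. Then all $w_{ij}$ and $g$ are square integrable, and the mean $\mu$ and the variance $\sigma^2$ of $g$ are $$\mu=E[W]^TA\,E[V],\qquad \sigma^2=\mathrm{trace}\big[A^TE[WW^T]\,A\,E[VV^T]\big]-\mu^2,$$ where $E[WW^T]$ (for $i=1$) and $E[VV^T]$ (for $i=2$) are the $(n_i+1)\times(n_i+1)$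 matrices with entries $e_{jk}=(s+n_i)^{-1}(s+n_i+1)^{-1}\tilde e_{jk}$, $0\le j,k\le n_i$, with $\tilde e_{jk}=s(1+s\,\delta_{jk})$ if $j=0$ or $k=0$, and $\tilde e_{jk}=1+\delta_{jk}$ otherwise ($\delta_{jk}$ is the Kronecker delta). -/

import Mathlib

open MeasureTheory ProbabilityTheory
open scoped ENNReal Matrix

noncomputable section

/-- The Gamma law with shape `a` and unit rate; for `a = 0` it is the point mass at `0`. -/
def gammaLaw (a : ℝ) : Measure ℝ :=
  if 0 < a then gammaMeasure a 1 else Measure.dirac 0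

/-- The Dirichlet distribution with nonnegative parameters `a i`, not all zero: the law of
`(Z i / ∑ j, Z j)` for independent `Z i` with Gamma laws of shapes `a i` and unit rate.
Coordinates with parameter `0` are almost surely `0`. -/
def dirichletLaw {ι : Type*} [Fintype ι] (a : ι → ℝ) : Measure (ι → ℝ) :=
  (Measure.pi fun i => gammaLaw (a i)).map fun z i => z i / ∑ j, z j

/-- A probability measure `μ` on the space of probability measures on `𝕏` is a Dirichlet process
with (finite) base measure `α` if for every finite measurable partition `B 0, …, B (m - 1)` of `𝕏`
the vector `(P (B 0), …, P (B (m - 1)))` is Dirichlet distributed with parameters `α (B i)`. -/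
def IsDirichletProcess {𝕏 : Type*} [MeasurableSpace 𝕏] (α : Measure 𝕏)
    (μ : ProbabilityMeasure (ProbabilityMeasure 𝕏)) : Prop :=
  ∀ (m : ℕ) (B : Fin m → Set 𝕏), (∀ i, MeasurableSet (B i)) →
    Pairwise (fun i j => Disjoint (B i) (B j)) → (⋃ i, B i) = Set.univ →
    (μ : Measure (ProbabilityMeasure 𝕏)).map
        (fun (P : ProbabilityMeasure 𝕏) i => (P : Measure 𝕏).real (B i)) =
      dirichletLaw fun i => α.real (B i)

/-- The base measure `s G` of the process `Dp(s, G)`. -/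
def priorBase (s : ℝ) (G : ProbabilityMeasure ℝ) : Measure ℝ :=
  ENNReal.ofReal s • (G : Measure ℝ)

/-- The base measure `s G + ∑ i, δ_{z i}` of the process
`Dp(s + n, (s G + ∑ i, δ_{z i}) / (s + n))`. -/
def updatedBase (s : ℝ) (G : ProbabilityMeasure ℝ) {n : ℕ} (z : Fin n → ℝ) : Measure ℝ :=
  priorBase s G + ∑ i, Measure.dirac (z i)

/-- The law of an i.i.d. sample of size `n` from `P`, as a kernel in `P`. -/
def iidSample (n : ℕ) : Kernel (ProbabilityMeasure ℝ) (Fin n → ℝ) where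
  toFun P := Measure.pi fun _ => (P : Measure ℝ)
  measurable' := by
    refine Measurable.measure_of_isPiSystem_of_isProbabilityMeasure
      (S := Set.pi Set.univ '' Set.pi Set.univ fun _ : Fin n => {t : Set ℝ | MeasurableSet t})
      generateFrom_pi.symm isPiSystem_pi ?_
    rintro _ ⟨t, ht, rfl⟩
    simp only [Measure.pi_pi]
    exact Finset.measurable_prod _ fun i _ =>
      (Measure.measurable_coe (show MeasurableSet (t i) from ht i (Set.mem_univ i))).comp
        measurable_subtype_coe

instance iidSample_isMarkovKernel (n : ℕ) : IsMarkovKernel (iidSample n) :=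
  ⟨fun P => inferInstanceAs (IsProbabilityMeasure (Measure.pi fun _ => (P : Measure ℝ)))⟩

/-- The law of the two samples: given `(F₁, F₂)`, the sample of size `n₁` is i.i.d. from `F₁`, the
sample of size `n₂` is i.i.d. from `F₂`, and the two samples are independent. -/
def twoSamples (n₁ n₂ : ℕ) :
    Kernel (ProbabilityMeasure ℝ × ProbabilityMeasure ℝ) ((Fin n₁ → ℝ) × (Fin n₂ → ℝ)) :=
  iidSample n₁ ∥ₖ iidSample n₂

/-- `κ` is the posterior law of `(F₁, F₂)` given the two samples, for the prior under which
`F₁ ∼ Dp(s, G₁)` and `F₂ ∼ Dp(s, G₂)` are independent.  The field `bayes` says that `κ` is a regular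
conditional distribution of `(F₁, F₂)` given the data.  This determines `κ` only up to null sets of
data, so the field `version` fixes the value at every data set: independent Dirichlet processes
with updated base measures. -/
structure IsPosterior (s : ℝ) (G₁ G₂ : ProbabilityMeasure ℝ) {n₁ n₂ : ℕ}
    (κ : Kernel ((Fin n₁ → ℝ) × (Fin n₂ → ℝ)) (ProbabilityMeasure ℝ × ProbabilityMeasure ℝ)) :
    Prop where
  bayes : ∃ μ₁ μ₂ : ProbabilityMeasure (ProbabilityMeasure ℝ),
    IsDirichletProcess (priorBase s G₁) μ₁ ∧ IsDirichletProcess (priorBase s G₂) μ₂ ∧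
    (((μ₁ : Measure (ProbabilityMeasure ℝ)).prod (μ₂ : Measure (ProbabilityMeasure ℝ))) ⊗ₘ
        twoSamples n₁ n₂).map Prod.swap =
      (twoSamples n₁ n₂ ∘ₘ
        ((μ₁ : Measure (ProbabilityMeasure ℝ)).prod (μ₂ : Measure (ProbabilityMeasure ℝ)))) ⊗ₘ κ
  version : ∀ (x : Fin n₁ → ℝ) (y : Fin n₂ → ℝ),
    ∃ ν₁ ν₂ : ProbabilityMeasure (ProbabilityMeasure ℝ),
      IsDirichletProcess (updatedBase s G₁ x) ν₁ ∧ IsDirichletProcess (updatedBase s G₂ y) ν₂ ∧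
      κ (x, y) = (ν₁ : Measure (ProbabilityMeasure ℝ)).prod (ν₂ : Measure (ProbabilityMeasure ℝ))

/-- `P(X ≤ Y)` for independent `X ∼ F₁` and `Y ∼ F₂`. -/
def probLE (F₁ F₂ : ProbabilityMeasure ℝ) : ℝ :=
  ((F₁ : Measure ℝ).prod (F₂ : Measure ℝ)).real {p | p.1 ≤ p.2}

/-- The posterior upper probability of `P(X ≤ Y) > c` given the data `x`, `y`, under the imprecise
Dirichlet process with strength `s`: the supremum, over all base probability measures `G₁`, `G₂`,
of the posterior probability of this event. -/
def upperPosteriorProb (s : ℝ) {n₁ n₂ : ℕ} (x : Fin n₁ → ℝ) (y : Fin n₂ → ℝ) (c : ℝ) : ℝ≥0∞ :=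
  sSup {p | ∃ (G₁ G₂ : ProbabilityMeasure ℝ)
    (κ : Kernel ((Fin n₁ → ℝ) × (Fin n₂ → ℝ)) (ProbabilityMeasure ℝ × ProbabilityMeasure ℝ)),
    IsPosterior s G₁ G₂ κ ∧ p = κ (x, y) {F | c < probLE F.1 F.2}}

/-- The law `Dir(s, 1, …, 1)` (with `n` ones) of the weights `(w₀, w₁, …, wₙ)`. -/
def weightLaw (s : ℝ) (n : ℕ) : Measure (Fin (n + 1) → ℝ) :=
  dirichletLaw (Fin.cons s fun _ : Fin n => 1)

/-- `w₁₀ w₂₀ + w₁₀ ∑ w₂ⱼ + w₂₀ ∑ w₁ⱼ + ∑ ∑ w₁ⱼ w₂ₖ I(xⱼ < yₖ)`. -/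
def gUpper {n₁ n₂ : ℕ} (x : Fin n₁ → ℝ) (y : Fin n₂ → ℝ)
    (w : (Fin (n₁ + 1) → ℝ) × (Fin (n₂ + 1) → ℝ)) : ℝ :=
  w.1 0 * w.2 0 + w.1 0 * ∑ j : Fin n₂, w.2 j.succ + w.2 0 * ∑ j : Fin n₁, w.1 j.succ +
    ∑ j : Fin n₁, ∑ k : Fin n₂, w.1 j.succ * w.2 k.succ * (if x j < y k then 1 else 0)

/-- The matrix `(I(xⱼ < yₖ))` with a row and a column of ones put in front. -/
def augmentedMatrix {n₁ n₂ : ℕ} (x : Fin n₁ → ℝ) (y : Fin n₂ → ℝ) :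
    Matrix (Fin (n₁ + 1)) (Fin (n₂ + 1)) ℝ :=
  Matrix.of (Fin.cons (fun _ => 1) fun j => Fin.cons 1 fun k => if x j < y k then 1 else 0)

/-- The vector `E[W]` for `W ∼ ρ`. -/
def meanVector {n : ℕ} (ρ : Measure (Fin n → ℝ)) : Fin n → ℝ :=
  fun j => ∫ w, w j ∂ρ

/-- The matrix `E[W Wᵀ]` for `W ∼ ρ`. -/
def secondMoment {n : ℕ} (ρ : Measure (Fin n → ℝ)) : Matrix (Fin n) (Fin n) ℝ :=
  Matrix.of fun j k => ∫ w, w j * w k ∂ρ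

/-- The explicit second moments of the weights; the index `0` is that of the weight with
parameter `s`. -/
def weightSecondMoment (s : ℝ) (n : ℕ) : Matrix (Fin (n + 1)) (Fin (n + 1)) ℝ :=
  Matrix.of fun j k => (s + n)⁻¹ * (s + n + 1)⁻¹ *
    (if j = 0 ∨ k = 0 then s * (1 + s * (if j = k then 1 else 0))
      else 1 + (if j = k then 1 else 0))

end

/-! The supremum is attained by sending the prior mass of `X` far to the left and that of `Y` far to
the right, so that it only helps the event `X ≤ Y`. Since the weights on each side sum to one, `g`
equals one minus the total weight `w₁ⱼ w₂ₖ` of the data pairs with `Yₖ ≤ Xⱼ`.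

Upper bound. The unnormalized base `sG + ∑ δ` splits into `n` unit pieces, one per observation, and
the pieces of `sG`. By the aggregation property, a single Dirichlet vector indexed by all pieces
yields both the posterior masses of the data points and a `Dir(s, 1, …, 1)` vector; each data point
receives at least the weights of its observations, the surplus coming from `sG`. Atom pairs in the
wrong order are lost for `P(X ≤ Y)`, so under this coupling `P(X ≤ Y)` is at most `g` almost surely,
whatever `G₁` and `G₂` are (`exists_coupling_updatedBase`, `probLE_le_one_sub`,
`posterior_probLE_le`).

Attainment. With point masses as base measures the posterior is an explicit discrete random measure
with Dirichlet weights. If the base atom of `X` lies below the data of `Y` and the base atom of `Y`,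
while the latter lies above the data of `X`, then `P(X ≤ Y)` is `g` itself
(`isPosterior_discretePosterior`, `posterior_extreme_ge`).

Moments. `g = Wᵀ A V` is bilinear in independent vectors, so its first two moments follow from those
of `W` and `V`. The Dirichlet second moments come from size-biasing: a factor `z j` under
independent Gamma laws raises the shape `a j` by one, which leaves only inverse moments of the Gamma
total. -/

instance isProbabilityMeasure_gammaLaw (a : ℝ) : IsProbabilityMeasure (gammaLaw a) := by
  unfold gammaLaw
  split_ifs with h
  · exact isProbabilityMeasure_gammaMeasure h one_pos
  · infer_instance

/-! ### Gamma laws: characteristic function and size-biasing -/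

lemma mgf_gammaMeasure_one {a t : ℝ} (ha : 0 < a) (ht : t < 1) :
    mgf id (gammaMeasure a 1) t = (1 - t) ^ (-a) := by
  have hpos : 0 < Real.Gamma a := Real.Gamma_pos_of_pos ha
  rw [mgf, gammaMeasure, integral_withDensity_eq_integral_toReal_smul₀
    (by unfold gammaPDF; fun_prop) (by simp [gammaPDF])]
  have h : ∀ x : ℝ, (gammaPDF a 1 x).toReal • Real.exp (t * id x) =
      (Set.Ici (0 : ℝ)).indicator
        (fun x => (Real.Gamma a)⁻¹ * (x ^ (a - 1) * Real.exp (-((1 - t) * x)))) x := by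
    intro x
    rw [gammaPDF, ENNReal.toReal_ofReal (gammaPDFReal_nonneg ha one_pos x), gammaPDFReal]
    by_cases hx : 0 ≤ x
    · rw [if_pos hx, Set.indicator_of_mem (Set.mem_Ici.2 hx), smul_eq_mul]
      simp only [Real.one_rpow, id, one_mul, one_div, mul_assoc, ← Real.exp_add]
      ring_nf
    · rw [if_neg hx, Set.indicator_of_notMem (by simpa using hx), zero_smul]
  simp_rw [h]
  rw [integral_indicator measurableSet_Ici, integral_Ici_eq_integral_Ioi, integral_const_mul,
    Real.integral_rpow_mul_exp_neg_mul_Ioi ha (by linarith), one_div,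
    Real.inv_rpow (by linarith), Real.rpow_neg (by linarith)]
  field_simp

lemma Iio_one_subset_integrableExpSet {a : ℝ} (ha : 0 < a) :
    Set.Iio 1 ⊆ integrableExpSet id (gammaMeasure a 1) := by
  intro t ht
  have := isProbabilityMeasure_gammaMeasure ha one_pos
  refine mgf_pos_iff.1 ?_
  rw [mgf_gammaMeasure_one ha ht]
  exact Real.rpow_pos_of_pos (by linarith [Set.mem_Iio.1 ht]) _

/-- Identity theorem: both sides are analytic on the half-plane `re z < 1`, where `1 - z` avoids the
branch cut, and they agree at real points near `0`. -/
lemma complexMGF_gammaMeasure_one {a : ℝ} (ha : 0 < a) {z : ℂ} (hz : z.re < 1) :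
    complexMGF id (gammaMeasure a 1) z = (1 - z) ^ (-a : ℂ) := by
  have hX : AnalyticOnNhd ℂ (complexMGF id (gammaMeasure a 1)) {z | z.re < 1} := by
    refine analyticOnNhd_complexMGF.mono fun z hz => ?_
    exact interior_mono (Iio_one_subset_integrableExpSet ha) (by simpa using hz)
  have hY : AnalyticOnNhd ℂ (fun z : ℂ => (1 - z) ^ (-a : ℂ)) {z | z.re < 1} := by
    intro z hz
    refine AnalyticAt.cpow (by fun_prop) (by fun_prop) (Or.inl ?_)
    simpa using hz
  refine AnalyticOnNhd.eqOn_of_preconnected_of_frequently_eq hX hY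
    ((convex_halfSpace_re_lt 1).isPreconnected) (z₀ := ((0 : ℝ) : ℂ)) (by simp) ?_ hz
  have h_real : ∃ᶠ x : ℝ in nhdsWithin 0 {0}ᶜ,
      complexMGF id (gammaMeasure a 1) x = (1 - x : ℂ) ^ (-a : ℂ) := by
    refine Filter.Eventually.frequently ?_
    filter_upwards [nhdsWithin_le_nhds (Iio_mem_nhds (zero_lt_one (α := ℝ)))] with t ht
    rw [complexMGF_ofReal, mgf_gammaMeasure_one ha ht,
      Complex.ofReal_cpow (by linarith [Set.mem_Iio.1 ht])]
    simp
  have hcont : Filter.Tendsto (fun x : ℝ => (x : ℂ)) (nhdsWithin 0 {0}ᶜ)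
      (nhdsWithin ((0 : ℝ) : ℂ) {((0 : ℝ) : ℂ)}ᶜ) := by
    refine tendsto_nhdsWithin_iff.2
      ⟨(Complex.continuous_ofReal.tendsto 0).mono_left nhdsWithin_le_nhds, ?_⟩
    filter_upwards [self_mem_nhdsWithin] with x hx
    simpa using hx
  exact hcont.frequently h_real

/-- The characteristic function of the Gamma law. -/
lemma charFun_gammaLaw {a : ℝ} (ha : 0 ≤ a) (t : ℝ) :
    charFun (gammaLaw a) t = (1 - t * Complex.I) ^ (-a : ℂ) := by
  rcases ha.eq_or_lt with rfl | ha
  · simp [gammaLaw, charFun_dirac]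
  · rw [gammaLaw, if_pos ha, ← complexMGF_id_mul_I, complexMGF_gammaMeasure_one ha (by simp)]

lemma gammaLaw_Iio_zero (a : ℝ) : gammaLaw a (Set.Iio 0) = 0 := by
  unfold gammaLaw
  split_ifs with h
  · rw [gammaMeasure, withDensity_apply _ measurableSet_Iio, lintegral_gammaPDF_of_nonpos le_rfl]
  · simp

lemma ae_nonneg_gammaLaw (a : ℝ) : ∀ᵐ z ∂gammaLaw a, 0 ≤ z := by
  rw [ae_iff]
  simpa [Set.Iio_def] using gammaLaw_Iio_zero a

lemma ae_pos_gammaLaw {a : ℝ} (ha : 0 < a) : ∀ᵐ z ∂gammaLaw a, 0 < z := by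
  have h : gammaLaw a {0} = 0 := by
    rw [gammaLaw, if_pos ha, gammaMeasure]
    exact withDensity_absolutelyContinuous _ _ (by simp)
  filter_upwards [ae_nonneg_gammaLaw a, measure_eq_zero_iff_ae_notMem.1 h] with z h₁ h₂
  exact h₁.lt_of_ne fun h => h₂ h.symm

/-- Size-biasing a Gamma law raises its shape by one. -/
lemma lintegral_ofReal_mul_gammaLaw {a : ℝ} (ha : 0 ≤ a) {f : ℝ → ℝ≥0∞} (hf : Measurable f) :
    ∫⁻ z, ENNReal.ofReal z * f z ∂gammaLaw a =
      ENNReal.ofReal a * ∫⁻ z, f z ∂gammaLaw (a + 1) := by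
  rcases ha.eq_or_lt with rfl | ha
  · simp [gammaLaw]
  have hm : ∀ b, Measurable (gammaPDF b 1) := fun b => by unfold gammaPDF; fun_prop
  rw [gammaLaw, gammaLaw, if_pos ha, if_pos (by linarith), gammaMeasure, gammaMeasure,
    lintegral_withDensity_eq_lintegral_mul _ (hm _) (by fun_prop),
    lintegral_withDensity_eq_lintegral_mul _ (hm _) hf, ← lintegral_const_mul _ (by fun_prop)]
  have h0 : ∀ᵐ z : ℝ, z ≠ 0 := by simp [ae_iff]
  refine lintegral_congr_ae ?_
  filter_upwards [h0] with z hz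
  simp only [Pi.mul_apply, ← mul_assoc]
  congr 1
  rcases lt_or_gt_of_ne hz with hz | hz
  · simp [gammaPDF_of_neg hz]
  · rw [gammaPDF_of_nonneg hz.le, gammaPDF_of_nonneg hz.le, ← ENNReal.ofReal_mul' hz.le,
      ← ENNReal.ofReal_mul ha.le, Real.Gamma_add_one ha.ne', add_sub_cancel_right,
      Real.rpow_sub_one hz.ne']
    have := (Real.Gamma_pos_of_pos ha).ne'
    congr 1
    simp only [Real.one_rpow]
    field_simp

/-! ### Dirichlet laws: aggregation and second moments -/

section Dirichlet

variable {ι κ : Type*} [Fintype ι] [Fintype κ]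

/-- Sums of independent Gamma variables over the fibres of a map are independent Gamma variables
whose shapes are summed over the fibres. -/
lemma map_fiberSum_pi_gammaLaw [DecidableEq κ] {a : ι → ℝ} (ha : ∀ i, 0 ≤ a i) (f : ι → κ) :
    (Measure.pi fun i => gammaLaw (a i)).map (fun z k => ∑ i with f i = k, z i) =
      Measure.pi fun k => gammaLaw (∑ i with f i = k, a i) := by
  classical
  let T : (ι → ℝ) →L[ℝ] (κ → ℝ) :=
    ContinuousLinearMap.pi fun k => ∑ i with f i = k, ContinuousLinearMap.proj i
  have hT : (fun (z : ι → ℝ) k => ∑ i with f i = k, z i) = T := by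
    ext z k
    simp [T]
  rw [hT]
  have : IsProbabilityMeasure ((Measure.pi fun i => gammaLaw (a i)).map T) :=
    Measure.isProbabilityMeasure_map T.continuous.measurable.aemeasurable
  refine Measure.ext_of_charFunDual (funext fun L => ?_)
  have hreal : ∀ (μ : Measure ℝ) (M : StrongDual ℝ ℝ), charFunDual μ M = charFun μ (M 1) := by
    intro μ M
    rw [charFunDual_apply, charFun_apply_real]
    congr 1 with x
    rw [show M x = M 1 * x by rw [mul_comm, ← smul_eq_mul, ← map_smul, smul_eq_mul, mul_one]]
    simp
  have hne : ∀ t : ℝ, (1 - t * Complex.I : ℂ) ≠ 0 := by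
    intro t h
    simpa using congrArg Complex.re h
  rw [charFunDual_map, charFunDual_pi, charFunDual_pi]
  simp_rw [hreal]
  -- All coordinates in the fibre over `k` see the same frequency `t = L (e k)`, and the factors `(1
  -- - it) ^ (-a i)` multiply to a power with the summed shape.
  rw [← Finset.prod_fiberwise Finset.univ f]
  refine Finset.prod_congr rfl fun k _ => ?_
  rw [charFun_gammaLaw (Finset.sum_nonneg fun i _ => ha i), Complex.ofReal_sum,
    ← Finset.sum_neg_distrib, Complex.cpow_def_of_ne_zero (hne _), Finset.mul_sum,
    Complex.exp_sum]
  refine Finset.prod_congr rfl fun i hi => ?_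
  have hTi : T (Pi.single i 1) = Pi.single k 1 := by
    ext l
    obtain rfl : f i = k := by simpa using hi
    simp only [← hT, Pi.single_apply, Finset.sum_ite_eq', Finset.mem_filter, Finset.mem_univ,
      true_and]
    exact if_congr eq_comm rfl rfl
  rw [charFun_gammaLaw (ha i), ← Complex.cpow_def_of_ne_zero (hne _)]
  simp [hTi]

lemma measurable_div_sum : Measurable fun (z : ι → ℝ) i => z i / ∑ j, z j := by
  fun_prop

instance isProbabilityMeasure_dirichletLaw (a : ι → ℝ) : IsProbabilityMeasure (dirichletLaw a) :=
  Measure.isProbabilityMeasure_map measurable_div_sum.aemeasurable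

/-- The aggregation property of the Dirichlet distribution. -/
lemma map_fiberSum_dirichletLaw [DecidableEq κ] {a : ι → ℝ} (ha : ∀ i, 0 ≤ a i) (f : ι → κ) :
    (dirichletLaw a).map (fun w k => ∑ i with f i = k, w i) =
      dirichletLaw fun k => ∑ i with f i = k, a i := by
  rw [dirichletLaw, dirichletLaw, ← map_fiberSum_pi_gammaLaw ha f,
    Measure.map_map (by fun_prop) measurable_div_sum,
    Measure.map_map measurable_div_sum (by fun_prop)]
  congr 1
  ext z k
  -- Summing over fibres does not change the total, so normalizing commutes with aggregating.
  simp only [Function.comp_apply, Finset.sum_div, Finset.sum_fiberwise]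

lemma ae_pi_gammaLaw_nonneg (a : ι → ℝ) :
    ∀ᵐ z ∂Measure.pi fun i => gammaLaw (a i), ∀ i, 0 ≤ z i :=
  ae_all_iff.2 fun i => Measure.tendsto_eval_ae_ae.eventually (ae_nonneg_gammaLaw (a i))

lemma ae_pi_gammaLaw_sum_pos {a : ι → ℝ} {i : ι} (hi : 0 < a i) :
    ∀ᵐ z ∂Measure.pi fun i => gammaLaw (a i), 0 < ∑ j, z j := by
  filter_upwards [ae_pi_gammaLaw_nonneg a,
    Measure.tendsto_eval_ae_ae.eventually (ae_pos_gammaLaw hi)] with z h₁ h₂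
  exact Finset.sum_pos' (fun j _ => h₁ j) ⟨i, Finset.mem_univ i, h₂⟩

/-- A Dirichlet vector with a positive parameter lies in the simplex almost surely. -/
lemma ae_dirichletLaw_mem_simplex {a : ι → ℝ} {i : ι} (hi : 0 < a i) :
    ∀ᵐ w ∂dirichletLaw a, (∀ j, 0 ≤ w j) ∧ ∑ j, w j = 1 := by
  have hm : MeasurableSet {w : ι → ℝ | (∀ j, 0 ≤ w j) ∧ ∑ j, w j = 1} := by
    measurability
  rw [dirichletLaw, ae_map_iff measurable_div_sum.aemeasurable hm]
  filter_upwards [ae_pi_gammaLaw_nonneg a, ae_pi_gammaLaw_sum_pos hi] with z h₁ h₂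
  exact ⟨fun j => div_nonneg (h₁ j) h₂.le, by rw [← Finset.sum_div, div_self h₂.ne']⟩

/-- Size-biasing a vector of independent Gamma variables by one coordinate. -/
lemma lintegral_ofReal_mul_pi_gammaLaw [DecidableEq ι] {a : ι → ℝ} (j : ι) (hj : 0 ≤ a j)
    {f : (ι → ℝ) → ℝ≥0∞} (hf : Measurable f) :
    ∫⁻ z, ENNReal.ofReal (z j) * f z ∂Measure.pi (fun i => gammaLaw (a i)) =
      ENNReal.ofReal (a j) *
        ∫⁻ z, f z ∂Measure.pi fun i => gammaLaw (a i + if i = j then 1 else 0) := by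
  let μ := Measure.pi fun i => gammaLaw (a i)
  let ν := Measure.pi fun i => gammaLaw (a i + if i = j then 1 else 0)
  have hm : Measurable fun z : ι → ℝ => ENNReal.ofReal (z j) := by fun_prop
  have hrect : ∀ s : ι → Set ℝ, (∀ i, MeasurableSet (s i)) →
      μ.withDensity (fun z => ENNReal.ofReal (z j)) (Set.univ.pi s) =
        ENNReal.ofReal (a j) * ν (Set.univ.pi s) := by
    intro s hs
    -- On a box the biased density is a product of one-coordinate functions, so independence reduces
    -- the claim to the one-dimensional size-biasing at `j`.
    let F : ι → ℝ → ℝ≥0∞ := fun i z =>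
      (if i = j then ENNReal.ofReal z else 1) * (s i).indicator 1 z
    have hF : ∀ i, Measurable (F i) := fun i => by
      refine Measurable.mul ?_ (measurable_one.indicator (hs i))
      split_ifs <;> fun_prop
    have h1 : μ.withDensity (fun z => ENNReal.ofReal (z j)) (Set.univ.pi s) =
        ∫⁻ z, ∏ i, F i (z i) ∂μ := by
      rw [withDensity_apply _ (MeasurableSet.univ_pi hs),
        ← lintegral_indicator (MeasurableSet.univ_pi hs)]
      congr 1 with z
      simp only [F, Finset.prod_mul_distrib, Finset.prod_ite_eq', Finset.mem_univ, if_true]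
      by_cases hz : z ∈ Set.univ.pi s
      · rw [Set.indicator_of_mem hz, Finset.prod_eq_one, mul_one]
        intro i _
        rw [Set.indicator_of_mem (hz i trivial), Pi.one_apply]
      · rw [Set.indicator_of_notMem hz]
        simp only [Set.mem_univ_pi, not_forall] at hz
        obtain ⟨i, hi⟩ := hz
        rw [Finset.prod_eq_zero (Finset.mem_univ i) (Set.indicator_of_notMem hi _), mul_zero]
    have hind := iIndepFun_pi (μ := fun i => gammaLaw (a i)) fun i => (hF i).aemeasurable
    rw [h1, lintegral_prod_eq_prod_lintegral_of_indepFun _ _ hind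
      fun i => (hF i).comp (measurable_pi_apply i), Measure.pi_pi,
      ← Finset.mul_prod_erase _ _ (Finset.mem_univ j),
      ← Finset.mul_prod_erase _ (fun i => gammaLaw _ (s i)) (Finset.mem_univ j), ← mul_assoc]
    have hev : ∀ i, ∫⁻ z, F i (z i) ∂μ = ∫⁻ z, F i z ∂gammaLaw (a i) := fun i =>
      (measurePreserving_eval (fun i => gammaLaw (a i)) i).lintegral_comp (hF i)
    congr 1
    · rw [hev]
      simp only [F, if_true]
      rw [lintegral_ofReal_mul_gammaLaw hj (measurable_one.indicator (hs j)),
        lintegral_indicator_one (hs j)]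
    · refine Finset.prod_congr rfl fun i hi => ?_
      have hij := Finset.ne_of_mem_erase hi
      rw [hev]
      simp only [F, if_neg hij, one_mul, add_zero]
      exact lintegral_indicator_one (hs i)
  have hmass : ∫⁻ z, ENNReal.ofReal (z j) ∂μ = ENNReal.ofReal (a j) := by
    simpa using hrect (fun _ => Set.univ) fun _ => MeasurableSet.univ
  have heq : μ.withDensity (fun z => ENNReal.ofReal (z j)) = ENNReal.ofReal (a j) • ν := by
    have : IsFiniteMeasure (μ.withDensity fun z => ENNReal.ofReal (z j)) :=
      isFiniteMeasure_withDensity (by rw [hmass]; exact ENNReal.ofReal_ne_top)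
    refine ext_of_generate_finite _ generateFrom_pi.symm isPiSystem_pi ?_ ?_
    · rintro _ ⟨s, hs, rfl⟩
      exact hrect s fun i => hs i trivial
    · simpa using hrect (fun _ => Set.univ) fun _ => MeasurableSet.univ
  have := lintegral_withDensity_eq_lintegral_mul μ hm hf
  rw [heq, lintegral_smul_measure] at this
  exact this.symm

/-- The total of independent Gamma variables is Gamma distributed. -/
lemma lintegral_comp_sum_pi_gammaLaw {a : ι → ℝ} (ha : ∀ i, 0 ≤ a i) {f : ℝ → ℝ≥0∞}
    (hf : Measurable f) :
    ∫⁻ z, f (∑ i, z i) ∂Measure.pi (fun i => gammaLaw (a i)) =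
      ∫⁻ z, f z ∂gammaLaw (∑ i, a i) := by
  have h := map_fiberSum_pi_gammaLaw ha fun _ : ι => ()
  have h' := (measurePreserving_eval
    (fun k : Unit => gammaLaw (∑ i with (fun _ : ι => ()) i = k, a i)) ()).lintegral_comp hf
  rw [← h, lintegral_map (by fun_prop) (by fun_prop)] at h'
  simpa using h'

/-- Size-biasing applied to `1 / z`: the integrand `z * (1 / z)` has integral one under shape `A`.
The next lemma repeats this with `1 / z ^ 2`. -/
lemma lintegral_inv_gammaLaw {A : ℝ} (hA : 0 < A) :
    ∫⁻ z, (ENNReal.ofReal z)⁻¹ ∂gammaLaw (A + 1) = (ENNReal.ofReal A)⁻¹ := by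
  have h := lintegral_ofReal_mul_gammaLaw hA.le (f := fun z => (ENNReal.ofReal z)⁻¹) (by fun_prop)
  have h1 : ∫⁻ z, ENNReal.ofReal z * (ENNReal.ofReal z)⁻¹ ∂gammaLaw A = 1 := by
    rw [lintegral_congr_ae (g := fun _ => 1)]
    · simp
    · filter_upwards [ae_pos_gammaLaw hA] with z hz
      exact ENNReal.mul_inv_cancel (by simpa using hz) ENNReal.ofReal_ne_top
  rw [h1] at h
  exact ENNReal.eq_inv_of_mul_eq_one_left (by rw [mul_comm]; exact h.symm)

lemma lintegral_inv_sq_gammaLaw {A : ℝ} (hA : 0 < A) :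
    ∫⁻ z, (ENNReal.ofReal z)⁻¹ * (ENNReal.ofReal z)⁻¹ ∂gammaLaw (A + 1 + 1) =
      (ENNReal.ofReal A)⁻¹ * (ENNReal.ofReal (A + 1))⁻¹ := by
  have hA1 : 0 < A + 1 := by linarith
  have h := lintegral_ofReal_mul_gammaLaw hA1.le
    (f := fun z => (ENNReal.ofReal z)⁻¹ * (ENNReal.ofReal z)⁻¹) (by fun_prop)
  have h1 : ∫⁻ z, ENNReal.ofReal z * ((ENNReal.ofReal z)⁻¹ * (ENNReal.ofReal z)⁻¹)
      ∂gammaLaw (A + 1) = (ENNReal.ofReal A)⁻¹ := by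
    rw [← lintegral_inv_gammaLaw hA]
    refine lintegral_congr_ae ?_
    filter_upwards [ae_pos_gammaLaw hA1] with z hz
    rw [← mul_assoc, ENNReal.mul_inv_cancel (by simpa using hz) ENNReal.ofReal_ne_top, one_mul]
  rw [← h1, h, mul_comm, ← mul_assoc, ENNReal.inv_mul_cancel (by simpa using hA1)
    ENNReal.ofReal_ne_top, one_mul]

/-- The second moments of the Dirichlet distribution. -/
lemma integral_mul_dirichletLaw [DecidableEq ι] {a : ι → ℝ} (ha : ∀ i, 0 ≤ a i)
    (hA : 0 < ∑ i, a i) (j k : ι) :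
    ∫ w, w j * w k ∂dirichletLaw a =
      a j * (a k + if k = j then 1 else 0) / ((∑ i, a i) * (∑ i, a i + 1)) := by
  obtain ⟨i₀, -, hi₀⟩ := Finset.exists_lt_of_sum_lt (s := Finset.univ) (f := fun _ => (0 : ℝ))
    (g := a) (by simpa using hA)
  have hδ : ∀ i : ι, (0 : ℝ) ≤ if i = j then 1 else 0 := fun i => by split_ifs <;> norm_num
  have hδ' : ∀ i : ι, (0 : ℝ) ≤ if i = k then 1 else 0 := fun i => by split_ifs <;> norm_num
  have hsum : ∑ i, (a i + (if i = j then 1 else 0) + if i = k then 1 else 0) =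
      ∑ i, a i + 1 + 1 := by
    simp [Finset.sum_add_distrib]
  rw [integral_eq_lintegral_of_nonneg_ae
    (by filter_upwards [ae_dirichletLaw_mem_simplex hi₀] with w hw
        exact mul_nonneg (hw.1 j) (hw.1 k)) (by fun_prop),
    dirichletLaw, lintegral_map (by fun_prop) measurable_div_sum]
  -- The factors `z j` and `z k` are absorbed one after the other as size-biasings. The second acts
  -- on shapes already raised at `j`, hence the Kronecker term; the total then has shape `∑ a + 2`.
  have h : ∫⁻ z, ENNReal.ofReal (z j / (∑ i, z i) * (z k / ∑ i, z i))
        ∂Measure.pi (fun i => gammaLaw (a i)) =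
      ∫⁻ z, ENNReal.ofReal (z j) * (ENNReal.ofReal (z k) *
        ((ENNReal.ofReal (∑ i, z i))⁻¹ * (ENNReal.ofReal (∑ i, z i))⁻¹))
        ∂Measure.pi (fun i => gammaLaw (a i)) := by
    refine lintegral_congr_ae ?_
    filter_upwards [ae_pi_gammaLaw_nonneg a, ae_pi_gammaLaw_sum_pos hi₀] with z h₁ h₂
    rw [ENNReal.ofReal_mul (div_nonneg (h₁ j) h₂.le), ENNReal.ofReal_div_of_pos h₂,
      ENNReal.ofReal_div_of_pos h₂, div_eq_mul_inv, div_eq_mul_inv]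
    ring
  rw [h, lintegral_ofReal_mul_pi_gammaLaw j (ha j) (by fun_prop),
    lintegral_ofReal_mul_pi_gammaLaw k (add_nonneg (ha k) (hδ k)) (by fun_prop),
    lintegral_comp_sum_pi_gammaLaw
      (f := fun x => (ENNReal.ofReal x)⁻¹ * (ENNReal.ofReal x)⁻¹)
      (fun i => add_nonneg (add_nonneg (ha i) (hδ i)) (hδ' i)) (by fun_prop),
    hsum, lintegral_inv_sq_gammaLaw hA]
  have hA1 : 0 < ∑ i, a i + 1 := by linarith
  simp only [ENNReal.toReal_mul, ENNReal.toReal_inv, ENNReal.toReal_ofReal (ha j),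
    ENNReal.toReal_ofReal (add_nonneg (ha k) (hδ k)), ENNReal.toReal_ofReal hA.le,
    ENNReal.toReal_ofReal hA1.le]
  field_simp

end Dirichlet

/-! ### Moments of bilinear forms in independent vectors -/

section Bilinear

variable {m n : ℕ} {ρ : Measure (Fin m → ℝ)} {τ : Measure (Fin n → ℝ)}

lemma bilinear_eq_sum (A : Matrix (Fin m) (Fin n) ℝ) (w : Fin m → ℝ) (v : Fin n → ℝ) :
    w ⬝ᵥ (A *ᵥ v) = ∑ j, ∑ k, A j k * (w j * v k) := by
  simp only [dotProduct, Matrix.mulVec, Finset.mul_sum]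
  exact Finset.sum_congr rfl fun j _ => Finset.sum_congr rfl fun k _ => by ring

/-- The mean of a bilinear form in two independent random vectors. -/
lemma integral_bilinear [IsFiniteMeasure ρ] [IsFiniteMeasure τ] (A : Matrix (Fin m) (Fin n) ℝ)
    (hρ : ∀ j, Integrable (fun w => w j) ρ) (hτ : ∀ k, Integrable (fun v => v k) τ) :
    ∫ p, p.1 ⬝ᵥ (A *ᵥ p.2) ∂(ρ.prod τ) = meanVector ρ ⬝ᵥ (A *ᵥ meanVector τ) := by
  have hint : ∀ j k, Integrable (fun p : (Fin m → ℝ) × (Fin n → ℝ) => A j k * (p.1 j * p.2 k))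
      (ρ.prod τ) := fun j k => ((hρ j).mul_prod (hτ k)).const_mul _
  simp_rw [bilinear_eq_sum]
  rw [integral_finsetSum _ fun j _ => integrable_finsetSum _ fun k _ => hint j k]
  refine Finset.sum_congr rfl fun j _ => ?_
  rw [integral_finsetSum _ fun k _ => hint j k]
  refine Finset.sum_congr rfl fun k _ => ?_
  rw [integral_const_mul, integral_prod_mul (fun w : Fin m → ℝ => w j) fun v : Fin n → ℝ => v k]
  rfl

lemma trace_eq_sum (A : Matrix (Fin m) (Fin n) ℝ) (S : Matrix (Fin m) (Fin m) ℝ)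
    (T : Matrix (Fin n) (Fin n) ℝ) :
    Matrix.trace (Aᵀ * S * A * T) =
      ∑ j, ∑ k, ∑ l, ∑ i, A j k * A l i * (S j l * T i k) := by
  simp only [Matrix.trace, Matrix.diag, Matrix.mul_apply, Matrix.transpose_apply, Finset.sum_mul]
  calc _ = ∑ k, ∑ j, ∑ i, ∑ l, A j k * A l i * (S j l * T i k) := by
        refine Finset.sum_congr rfl fun k _ => ?_
        rw [Finset.sum_congr rfl fun i _ => Finset.sum_comm, Finset.sum_comm]
        refine Finset.sum_congr rfl fun j _ => Finset.sum_congr rfl fun i _ =>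
          Finset.sum_congr rfl fun l _ => by ring
    _ = _ := by
        rw [Finset.sum_comm]
        exact Finset.sum_congr rfl fun j _ => Finset.sum_congr rfl fun k _ => Finset.sum_comm

/-- The second moment of a bilinear form in two independent random vectors. -/
lemma integral_bilinear_sq [IsFiniteMeasure ρ] [IsFiniteMeasure τ] (A : Matrix (Fin m) (Fin n) ℝ)
    (hρ : ∀ j, MemLp (fun w => w j) 2 ρ) (hτ : ∀ k, MemLp (fun v => v k) 2 τ) :
    ∫ p, (p.1 ⬝ᵥ (A *ᵥ p.2)) ^ 2 ∂(ρ.prod τ) =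
      Matrix.trace (Aᵀ * secondMoment ρ * A * secondMoment τ) := by
  have hint : ∀ j k l i, Integrable (fun p : (Fin m → ℝ) × (Fin n → ℝ) =>
      A j k * A l i * ((p.1 j * p.1 l) * (p.2 i * p.2 k))) (ρ.prod τ) := fun j k l i =>
    (((hρ j).integrable_mul (hρ l)).mul_prod ((hτ i).integrable_mul (hτ k))).const_mul _
  have hsq : ∀ p : (Fin m → ℝ) × (Fin n → ℝ), (p.1 ⬝ᵥ (A *ᵥ p.2)) ^ 2 =
      ∑ j, ∑ k, ∑ l, ∑ i, A j k * A l i * ((p.1 j * p.1 l) * (p.2 i * p.2 k)) := by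
    intro p
    rw [bilinear_eq_sum, sq]
    simp only [Finset.sum_mul]
    simp only [Finset.mul_sum]
    exact Finset.sum_congr rfl fun j _ => Finset.sum_congr rfl fun k _ =>
      Finset.sum_congr rfl fun l _ => Finset.sum_congr rfl fun i _ => by ring
  simp_rw [hsq]
  rw [trace_eq_sum, integral_finsetSum _ fun j _ => integrable_finsetSum _ fun k _ =>
    integrable_finsetSum _ fun l _ => integrable_finsetSum _ fun i _ => hint j k l i]
  refine Finset.sum_congr rfl fun j _ => ?_
  rw [integral_finsetSum _ fun k _ => integrable_finsetSum _ fun l _ =>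
    integrable_finsetSum _ fun i _ => hint j k l i]
  refine Finset.sum_congr rfl fun k _ => ?_
  rw [integral_finsetSum _ fun l _ => integrable_finsetSum _ fun i _ => hint j k l i]
  refine Finset.sum_congr rfl fun l _ => ?_
  rw [integral_finsetSum _ fun i _ => hint j k l i]
  refine Finset.sum_congr rfl fun i _ => ?_
  rw [integral_const_mul, integral_prod_mul (fun w : Fin m → ℝ => w j * w l)
    fun v : Fin n → ℝ => v i * v k]
  rfl

end Bilinear

/-! ### The weights `Dir(s, 1, …, 1)` and the variable `g` -/

section Weights

variable {s : ℝ}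

lemma weightParam_nonneg (hs : 0 ≤ s) (n : ℕ) (i : Fin (n + 1)) :
    0 ≤ (Fin.cons s fun _ : Fin n => 1 : Fin (n + 1) → ℝ) i := by
  induction i using Fin.cases <;> simp [hs]

lemma sum_weightParam (s : ℝ) (n : ℕ) :
    ∑ i, (Fin.cons s fun _ : Fin n => 1 : Fin (n + 1) → ℝ) i = s + n := by
  simp [Fin.sum_univ_succ]

instance isProbabilityMeasure_weightLaw (s : ℝ) (n : ℕ) : IsProbabilityMeasure (weightLaw s n) :=
  inferInstanceAs (IsProbabilityMeasure (dirichletLaw _))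

lemma ae_weightLaw_mem_simplex (hs : 0 < s) (n : ℕ) :
    ∀ᵐ w ∂weightLaw s n, (∀ j, 0 ≤ w j) ∧ ∑ j, w j = 1 :=
  ae_dirichletLaw_mem_simplex (i := 0) (by simpa using hs)

lemma memLp_weight (hs : 0 < s) (n : ℕ) (j : Fin (n + 1)) :
    MemLp (fun w => w j) 2 (weightLaw s n) := by
  refine MemLp.of_bound (Measurable.aestronglyMeasurable (by fun_prop)) 1 ?_
  filter_upwards [ae_weightLaw_mem_simplex hs n] with w hw
  rw [Real.norm_of_nonneg (hw.1 j), ← hw.2]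
  exact Finset.single_le_sum (fun i _ => hw.1 i) (Finset.mem_univ j)

lemma secondMoment_weightLaw (hs : 0 < s) (n : ℕ) :
    secondMoment (weightLaw s n) = weightSecondMoment s n := by
  have hA : 0 < s + n := by positivity
  ext j k
  have h := integral_mul_dirichletLaw (weightParam_nonneg hs.le n)
    (by rw [sum_weightParam]; exact hA) j k
  rw [sum_weightParam] at h
  rw [secondMoment, Matrix.of_apply, weightLaw, h, weightSecondMoment, Matrix.of_apply,
    div_eq_mul_inv, mul_inv, mul_comm]
  congr 1
  induction j using Fin.cases <;> induction k using Fin.cases <;>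
    simp [eq_comm, Fin.succ_ne_zero, add_comm]

variable {n₁ n₂ : ℕ} (x : Fin n₁ → ℝ) (y : Fin n₂ → ℝ)

lemma gUpper_eq_bilinear (w : (Fin (n₁ + 1) → ℝ) × (Fin (n₂ + 1) → ℝ)) :
    gUpper x y w = w.1 ⬝ᵥ (augmentedMatrix x y *ᵥ w.2) := by
  rw [bilinear_eq_sum]
  simp only [gUpper, augmentedMatrix, Fin.sum_univ_succ, Matrix.of_apply, Fin.cons_zero,
    Fin.cons_succ, one_mul, Finset.sum_add_distrib, Finset.mul_sum]
  simp only [mul_comm, add_assoc, add_left_comm]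

lemma measurable_gUpper : Measurable (gUpper x y) := by
  unfold gUpper
  fun_prop

lemma memLp_gUpper (hs : 0 < s) :
    MemLp (gUpper x y) 2 ((weightLaw s n₁).prod (weightLaw s n₂)) := by
  have h : gUpper x y = fun w => ∑ j, ∑ k, augmentedMatrix x y j k * (w.1 j * w.2 k) := by
    ext w
    rw [gUpper_eq_bilinear, bilinear_eq_sum]
  rw [h]
  refine memLp_finsetSum _ fun j _ => memLp_finsetSum _ fun k _ => MemLp.const_mul ?_ _
  refine MemLp.of_bound (Measurable.aestronglyMeasurable (by fun_prop)) 1 ?_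
  filter_upwards [Measure.quasiMeasurePreserving_fst.ae (ae_weightLaw_mem_simplex hs n₁),
    Measure.quasiMeasurePreserving_snd.ae (ae_weightLaw_mem_simplex hs n₂)] with w h₁ h₂
  rw [Real.norm_of_nonneg (mul_nonneg (h₁.1 j) (h₂.1 k))]
  refine mul_le_one₀ ?_ (h₂.1 k) ?_
  · rw [← h₁.2]
    exact Finset.single_le_sum (fun i _ => h₁.1 i) (Finset.mem_univ j)
  · rw [← h₂.2]
    exact Finset.single_le_sum (fun i _ => h₂.1 i) (Finset.mem_univ k)

lemma integral_gUpper (hs : 0 < s) :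
    ∫ w, gUpper x y w ∂((weightLaw s n₁).prod (weightLaw s n₂)) =
      meanVector (weightLaw s n₁) ⬝ᵥ
        (augmentedMatrix x y *ᵥ meanVector (weightLaw s n₂)) := by
  simp_rw [gUpper_eq_bilinear]
  exact integral_bilinear _ (fun j => (memLp_weight hs n₁ j).integrable (by norm_num))
    fun k => (memLp_weight hs n₂ k).integrable (by norm_num)

lemma variance_gUpper (hs : 0 < s) :
    variance (gUpper x y) ((weightLaw s n₁).prod (weightLaw s n₂)) =
      Matrix.trace ((augmentedMatrix x y)ᵀ * secondMoment (weightLaw s n₁) *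
        augmentedMatrix x y * secondMoment (weightLaw s n₂)) -
      (meanVector (weightLaw s n₁) ⬝ᵥ
        (augmentedMatrix x y *ᵥ meanVector (weightLaw s n₂))) ^ 2 := by
  rw [variance_eq_sub (memLp_gUpper x y hs), integral_gUpper x y hs,
    ← integral_bilinear_sq _ (memLp_weight hs n₁) (memLp_weight hs n₂)]
  simp only [Pi.pow_apply, gUpper_eq_bilinear]

/-- Almost surely, `gUpper` is one minus the weight of the pairs with `y k ≤ x j`. -/
lemma gUpper_eq_one_sub {w : (Fin (n₁ + 1) → ℝ) × (Fin (n₂ + 1) → ℝ)}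
    (h₁ : ∑ j, w.1 j = 1) (h₂ : ∑ k, w.2 k = 1) :
    gUpper x y w =
      1 - ∑ j : Fin n₁, ∑ k : Fin n₂, w.1 j.succ * w.2 k.succ * (if y k ≤ x j then 1 else 0) := by
  rw [eq_sub_iff_add_eq, gUpper, add_assoc, ← Finset.sum_add_distrib]
  have h : ∀ j : Fin n₁, ∑ k : Fin n₂, w.1 j.succ * w.2 k.succ * (if x j < y k then 1 else 0) +
      ∑ k : Fin n₂, w.1 j.succ * w.2 k.succ * (if y k ≤ x j then 1 else 0) =
      w.1 j.succ * ∑ k : Fin n₂, w.2 k.succ := by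
    intro j
    rw [← Finset.sum_add_distrib, Finset.mul_sum]
    refine Finset.sum_congr rfl fun k _ => ?_
    rcases lt_or_ge (x j) (y k) with h | h
    · simp [h, h.not_ge]
    · simp [h, h.not_gt]
  simp_rw [h]
  rw [← Finset.sum_mul]
  rw [Fin.sum_univ_succ] at h₁ h₂
  -- This is the expansion of `(∑ w₁ⱼ) (∑ w₂ₖ) = 1`.
  linear_combination (w.2 0 + ∑ k : Fin n₂, w.2 k.succ) * h₁ + h₂

end Weights

/-! ### Upper bound by coupling -/

section UpperBound

lemma measurable_real_apply {𝕏 : Type*} [MeasurableSpace 𝕏] {s : Set 𝕏} (hs : MeasurableSet s) :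
    Measurable fun P : ProbabilityMeasure 𝕏 => (P : Measure 𝕏).real s :=
  ((Measure.measurable_coe hs).comp measurable_subtype_coe).ennreal_toReal

/-- The defining property of a Dirichlet process for partitions with an arbitrary finite index
type. -/
lemma IsDirichletProcess.map_partition {𝕏 κ : Type*} [MeasurableSpace 𝕏] [Fintype κ]
    {α : Measure 𝕏} {μ : ProbabilityMeasure (ProbabilityMeasure 𝕏)}
    (h : IsDirichletProcess α μ) {B : κ → Set 𝕏} (hB : ∀ k, MeasurableSet (B k))
    (hd : Pairwise (Function.onFun Disjoint B)) (hU : ⋃ k, B k = Set.univ) :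
    (μ : Measure (ProbabilityMeasure 𝕏)).map
        (fun (P : ProbabilityMeasure 𝕏) k => (P : Measure 𝕏).real (B k)) =
      dirichletLaw fun k => α.real (B k) := by
  classical
  let e := Fintype.equivFin κ
  have hmeas : Measurable fun (P : ProbabilityMeasure 𝕏) i => (P : Measure 𝕏).real (B (e.symm i)) :=
    measurable_pi_lambda _ fun i => measurable_real_apply (hB _)
  have hsum : ∀ (g : Fin (Fintype.card κ) → ℝ) k, ∑ i with e.symm i = k, g i = g (e k) := by
    intro g k
    rw [Finset.sum_eq_single_of_mem (e k) (by simp)]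
    intro i hi hik
    exact absurd ((Equiv.symm_apply_eq e).1 (Finset.mem_filter.1 hi).2) hik
  have h1 := h _ (fun i => B (e.symm i)) (fun i => hB _)
    (fun i j hij => hd (e.symm.injective.ne hij)) (by rw [← hU]; exact e.symm.surjective.iUnion_comp B)
  have h2 := map_fiberSum_dirichletLaw
    (a := fun i => α.real (B (e.symm i))) (fun _ => measureReal_nonneg) e.symm
  rw [← h1, Measure.map_map (by fun_prop) hmeas] at h2
  simp only [hsum, Equiv.symm_apply_apply] at h2
  rw [← h2]
  congr 1
  ext P k
  simp only [Function.comp_apply, Equiv.symm_apply_apply]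

/-- The partition of the line into the singletons of a finite set and the rest. -/
def atomPartition (X : Finset ℝ) : Option X → Set ℝ
  | none => (X : Set ℝ)ᶜ
  | some a => {(a : ℝ)}

lemma measurableSet_atomPartition (X : Finset ℝ) (o : Option X) :
    MeasurableSet (atomPartition X o) := by
  cases o with
  | none => exact X.measurableSet.compl
  | some a => exact measurableSet_singleton _

lemma pairwise_disjoint_atomPartition (X : Finset ℝ) :
    Pairwise (Function.onFun Disjoint (atomPartition X)) := by
  rintro (_ | a) (_ | b) hab
  · exact absurd rfl hab
  · simp [Function.onFun, atomPartition]
  · simp [Function.onFun, atomPartition]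
  · exact Set.disjoint_singleton.2 fun h => hab (congrArg some (Subtype.ext h))

lemma iUnion_atomPartition (X : Finset ℝ) : ⋃ o, atomPartition X o = Set.univ := by
  refine Set.eq_univ_of_forall fun a => Set.mem_iUnion.2 ?_
  by_cases ha : a ∈ X
  · exact ⟨some ⟨a, ha⟩, rfl⟩
  · exact ⟨none, ha⟩

/-- The atoms of a Dirichlet process with updated base measure at the data points are coupled with
the weights of law `Dir(s, 1, …, 1)` so that they dominate the weights of the data points. -/
lemma exists_coupling_updatedBase {s : ℝ} (hs : 0 < s) (G : ProbabilityMeasure ℝ) {n : ℕ}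
    (z : Fin n → ℝ) {ν : ProbabilityMeasure (ProbabilityMeasure ℝ)}
    (hν : IsDirichletProcess (updatedBase s G z) ν) :
    ∃ π : Measure ((Finset.univ.image z → ℝ) × (Fin (n + 1) → ℝ)), IsProbabilityMeasure π ∧
      π.map Prod.fst = (ν : Measure (ProbabilityMeasure ℝ)).map
        (fun (P : ProbabilityMeasure ℝ) (a : Finset.univ.image z) =>
          (P : Measure ℝ).real {(a : ℝ)}) ∧
      π.map Prod.snd = weightLaw s n ∧
      ∀ᵐ p ∂π, (∀ j, 0 ≤ p.2 j) ∧ ∑ j, p.2 j = 1 ∧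
        ∀ a : Finset.univ.image z, ∑ j with z j = a, p.2 (Fin.succ j) ≤ p.1 a := by
  classical
  let X := Finset.univ.image z
  let B := atomPartition X
  -- The base measure is cut into `n` unit pieces and the pieces of `sG` on each cell. The map `f`
  -- sends every piece to its cell, giving the process on the partition; `h` keeps the unit pieces
  -- apart and merges all of `sG` into index `0`, giving the weights. Ties within the sample are
  -- harmless, as `f` need not be injective on the unit pieces.
  let loc : Fin n → Option X := fun j => some ⟨z j, Finset.mem_image_of_mem z (Finset.mem_univ j)⟩
  let b : Fin n ⊕ Option X → ℝ := Sum.elim (fun _ => 1) fun o => s * (G : Measure ℝ).real (B o)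
  have hb : ∀ i, 0 ≤ b i := by
    rintro (i | o)
    · exact zero_le_one
    · exact mul_nonneg hs.le measureReal_nonneg
  let f : Fin n ⊕ Option X → Option X := Sum.elim loc id
  let h : Fin n ⊕ Option X → Fin (n + 1) := Sum.elim Fin.succ fun _ => 0
  have hBmeas := measurableSet_atomPartition X
  have hf : ∀ (u : Fin n ⊕ Option X → ℝ) (o : Option X),
      ∑ i with f i = o, u i = ∑ j with loc j = o, u (Sum.inl j) + u (Sum.inr o) := by
    intro u o
    rw [Finset.sum_filter, Fintype.sum_sum_type, Finset.sum_filter]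
    congr 1
    exact (Finset.sum_eq_single_of_mem o (Finset.mem_univ o) fun i _ hi => if_neg hi).trans
      (if_pos rfl)
  have hh : ∀ (u : Fin n ⊕ Option X → ℝ) (j : Fin n),
      ∑ i with h i = j.succ, u i = u (Sum.inl j) := by
    intro u j
    rw [Finset.sum_filter, Fintype.sum_sum_type]
    simp [h, (Fin.succ_ne_zero _).symm, -Fintype.sum_option]
  have hh0 : ∀ u : Fin n ⊕ Option X → ℝ, ∑ i with h i = 0, u i = ∑ o, u (Sum.inr o) := by
    intro u
    rw [Finset.sum_filter, Fintype.sum_sum_type]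
    simp [h, Fin.succ_ne_zero, -Fintype.sum_option]
  have hlocB : ∀ j o, z j ∈ B o ↔ loc j = o := by
    rintro j (_ | a)
    · simp [B, atomPartition, loc, X]
    · simp [B, atomPartition, loc, Subtype.ext_iff]
  have : IsFiniteMeasure (ENNReal.ofReal s • (G : Measure ℝ)) :=
    Measure.smul_finite _ ENNReal.ofReal_ne_top
  have hbase : (fun o => (updatedBase s G z).real (B o)) = fun o => ∑ i with f i = o, b i := by
    ext o
    rw [hf, updatedBase, priorBase, measureReal_add_apply (measure_ne_top _ _) (measure_ne_top _ _), measureReal_ennreal_smul_apply,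
      ENNReal.toReal_ofReal hs.le, measureReal_def (∑ i, Measure.dirac (z i)),
      Measure.finsetSum_apply, ENNReal.toReal_sum (fun _ _ => measure_ne_top _ _), add_comm,
      Finset.sum_filter]
    congr 1
    refine Finset.sum_congr rfl fun j _ => ?_
    rw [Measure.dirac_apply' _ (hBmeas o), Set.indicator_apply]
    simp only [B, b, ← hlocB, Sum.elim_inl]
    split_ifs <;> simp
  have hbsum : ∑ o, b (Sum.inr o) = s := by
    simp only [b, Sum.elim_inr, ← Finset.mul_sum]
    rw [← measureReal_iUnion_fintype (pairwise_disjoint_atomPartition X) hBmeas,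
      iUnion_atomPartition, probReal_univ, mul_one]
  have hweight : (fun k => ∑ i with h i = k, b i) =
      (Fin.cons s fun _ : Fin n => 1 : Fin (n + 1) → ℝ) := by
    ext k
    induction k using Fin.cases with
    | zero => rw [hh0, hbsum, Fin.cons_zero]
    | succ j => simp [hh, b]
  have hΦ : Measurable fun (u : Fin n ⊕ Option X → ℝ) =>
      ((fun a : X => ∑ i with f i = some a, u i), fun k => ∑ i with h i = k, u i) := by
    fun_prop
  have hpos : ∃ i, 0 < b i := by
    by_contra! hle
    linarith [Finset.sum_nonpos fun o (_ : o ∈ Finset.univ) => hle (Sum.inr o)]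
  obtain ⟨i₀, hi₀⟩ := hpos
  refine ⟨(dirichletLaw b).map _, Measure.isProbabilityMeasure_map hΦ.aemeasurable, ?_, ?_, ?_⟩
  · have h1 := hν.map_partition hBmeas (pairwise_disjoint_atomPartition X)
      (iUnion_atomPartition X)
    rw [hbase, ← map_fiberSum_dirichletLaw hb f] at h1
    have h2 := congrArg (Measure.map fun (p : Option X → ℝ) (a : X) => p (some a)) h1
    rw [Measure.map_map (by fun_prop) (measurable_pi_lambda _ fun o =>
      measurable_real_apply (hBmeas o)), Measure.map_map (by fun_prop) (by fun_prop)] at h2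
    rw [Measure.map_map measurable_fst hΦ]
    exact h2.symm
  · rw [Measure.map_map measurable_snd hΦ, weightLaw, ← hweight, ← map_fiberSum_dirichletLaw hb h]
    rfl
  · have hS : MeasurableSet {p : (X → ℝ) × (Fin (n + 1) → ℝ) | (∀ j, 0 ≤ p.2 j) ∧
        ∑ j, p.2 j = 1 ∧ ∀ a : X, ∑ j with z j = a, p.2 (Fin.succ j) ≤ p.1 a} := by
      simp only [Set.ofPred_and, Set.ofPred_forall]
      exact (MeasurableSet.iInter fun j => measurableSet_le (by fun_prop) (by fun_prop)).inter
        ((measurableSet_eq_fun (by fun_prop) (by fun_prop)).inter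
          (MeasurableSet.iInter fun a => measurableSet_le (by fun_prop) (by fun_prop)))
    refine (ae_map_iff hΦ.aemeasurable hS).2 ?_
    filter_upwards [ae_dirichletLaw_mem_simplex hi₀] with u hu
    refine ⟨fun j => Finset.sum_nonneg fun i _ => hu.1 i, ?_, fun a => ?_⟩
    · rw [Finset.sum_fiberwise, hu.2]
    · simp only [hh, hf]
      have : ∀ j, z j = a ↔ loc j = some a := fun j => by simp [loc, Subtype.ext_iff]
      simp only [this]
      -- The surplus of the atom over its observations is the nonnegative weight of `sG` at `a`.
      linarith [hu.1 (Sum.inr (some a))]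

/-- Atoms of the two distributions in the wrong order are lost for `P(X ≤ Y)`. -/
lemma probLE_le_one_sub (F₁ F₂ : ProbabilityMeasure ℝ) (X Y : Finset ℝ) :
    probLE F₁ F₂ ≤ 1 - ∑ a : X, ∑ b : Y, (F₁ : Measure ℝ).real {(a : ℝ)} *
      (F₂ : Measure ℝ).real {(b : ℝ)} * (if (b : ℝ) < a then 1 else 0) := by
  let ρ := (F₁ : Measure ℝ).prod (F₂ : Measure ℝ)
  have hmeas : MeasurableSet {p : ℝ × ℝ | p.1 ≤ p.2} :=
    measurableSet_le measurable_fst measurable_snd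
  have hcompl : probLE F₁ F₂ = 1 - ρ.real {p : ℝ × ℝ | p.1 ≤ p.2}ᶜ := by
    rw [probReal_compl_eq_one_sub hmeas, sub_sub_cancel, probLE]
  rw [hcompl]
  refine sub_le_sub_left ?_ 1
  have hsub : (((X ×ˢ Y).filter fun p : ℝ × ℝ => p.2 < p.1 : Finset (ℝ × ℝ)) : Set (ℝ × ℝ)) ⊆
      {p : ℝ × ℝ | p.1 ≤ p.2}ᶜ := by
    intro p hp
    simpa using (Finset.mem_filter.1 hp).2
  refine le_trans (le_of_eq ?_) (measureReal_mono hsub)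
  rw [← sum_measureReal_singleton, Finset.sum_filter, Finset.sum_product,
    ← Finset.sum_coe_sort X]
  refine Finset.sum_congr rfl fun a _ => ?_
  rw [← Finset.sum_coe_sort Y]
  refine Finset.sum_congr rfl fun b _ => ?_
  rw [← Set.singleton_prod_singleton, measureReal_prod_prod]
  split_ifs <;> simp

/-- Passes from sums over observations to sums over distinct data values, where the masses of the
atoms live; values may repeat within a sample. -/
lemma sum_fiberwise_image {n₁ n₂ : ℕ} (x : Fin n₁ → ℝ) (y : Fin n₂ → ℝ) (w : Fin n₁ → ℝ)
    (v : Fin n₂ → ℝ) (φ : ℝ → ℝ → ℝ) :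
    ∑ j, ∑ k, w j * v k * φ (x j) (y k) =
      ∑ a : Finset.univ.image x, ∑ b : Finset.univ.image y,
        (∑ j with x j = a, w j) * (∑ k with y k = b, v k) * φ a b := by
  have hin : ∀ j, ∑ k, w j * v k * φ (x j) (y k) =
      ∑ b : Finset.univ.image y, w j * (∑ k with y k = b, v k) * φ (x j) b := by
    intro j
    rw [Finset.sum_coe_sort (Finset.univ.image y)
      (fun b => w j * (∑ k with y k = b, v k) * φ (x j) b),
      ← Finset.sum_fiberwise_of_maps_to (g := y)
        (fun k _ => Finset.mem_image_of_mem y (Finset.mem_univ k))]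
    refine Finset.sum_congr rfl fun b _ => ?_
    rw [Finset.mul_sum, Finset.sum_mul]
    refine Finset.sum_congr rfl fun k hk => ?_
    rw [(Finset.mem_filter.1 hk).2]
  simp_rw [hin]
  rw [Finset.sum_coe_sort (Finset.univ.image x) (fun a => ∑ b : Finset.univ.image y,
      (∑ j with x j = a, w j) * (∑ k with y k = b, v k) * φ a b),
    ← Finset.sum_fiberwise_of_maps_to (g := x)
      (fun j _ => Finset.mem_image_of_mem x (Finset.mem_univ j))]
  refine Finset.sum_congr rfl fun a _ => ?_
  rw [Finset.sum_comm]
  refine Finset.sum_congr rfl fun b _ => ?_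
  rw [Finset.sum_mul, Finset.sum_mul]
  refine Finset.sum_congr rfl fun j hj => ?_
  rw [(Finset.mem_filter.1 hj).2]

/-- The event depends on the random measures only through an upper bound in the atom masses at the
data. The product of the two couplings carries these masses to the weights, and heavier atoms only
increase the loss from wrongly ordered pairs. -/
lemma posterior_probLE_le {s : ℝ} (hs : 0 < s) {n₁ n₂ : ℕ} {x : Fin n₁ → ℝ} {y : Fin n₂ → ℝ}
    (no_ties : ∀ i j, x i ≠ y j) {G₁ G₂ : ProbabilityMeasure ℝ}
    {ν₁ ν₂ : ProbabilityMeasure (ProbabilityMeasure ℝ)}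
    (h₁ : IsDirichletProcess (updatedBase s G₁ x) ν₁)
    (h₂ : IsDirichletProcess (updatedBase s G₂ y) ν₂) (c : ℝ) :
    ((ν₁ : Measure (ProbabilityMeasure ℝ)).prod (ν₂ : Measure (ProbabilityMeasure ℝ)))
        {F | c < probLE F.1 F.2} ≤
      ((weightLaw s n₁).prod (weightLaw s n₂)) {w | c < gUpper x y w} := by
  obtain ⟨π₁, _, hfst₁, hsnd₁, hae₁⟩ := exists_coupling_updatedBase hs G₁ x h₁
  obtain ⟨π₂, _, hfst₂, hsnd₂, hae₂⟩ := exists_coupling_updatedBase hs G₂ y h₂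
  let X := Finset.univ.image x
  let Y := Finset.univ.image y
  let Ψ : (X → ℝ) × (Y → ℝ) → ℝ := fun p =>
    1 - ∑ a, ∑ b, p.1 a * p.2 b * (if (b : ℝ) < a then 1 else 0)
  have hΨ : MeasurableSet {p | c < Ψ p} := measurableSet_lt measurable_const (by fun_prop)
  have hatoms : ∀ Z : Finset ℝ, Measurable fun (P : ProbabilityMeasure ℝ) (a : Z) =>
      (P : Measure ℝ).real {(a : ℝ)} := fun Z => measurable_pi_lambda _ fun a =>
    measurable_real_apply (measurableSet_singleton _)
  calc _ ≤ ((ν₁ : Measure (ProbabilityMeasure ℝ)).prod (ν₂ : Measure (ProbabilityMeasure ℝ)))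
          (Prod.map (fun P (a : X) => (P : Measure ℝ).real {(a : ℝ)})
            (fun P (b : Y) => (P : Measure ℝ).real {(b : ℝ)}) ⁻¹' {p | c < Ψ p}) :=
        measure_mono fun F hF => lt_of_lt_of_le hF (probLE_le_one_sub F.1 F.2 X Y)
    _ = (π₁.prod π₂) (Prod.map Prod.fst Prod.fst ⁻¹' {p | c < Ψ p}) := by
        rw [← Measure.map_apply ((hatoms X).prodMap (hatoms Y)) hΨ,
          ← Measure.map_prod_map _ _ (hatoms X) (hatoms Y), ← hfst₁, ← hfst₂,
          Measure.map_prod_map _ _ measurable_fst measurable_fst,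
          Measure.map_apply (measurable_fst.prodMap measurable_fst) hΨ]
    _ ≤ (π₁.prod π₂) (Prod.map Prod.snd Prod.snd ⁻¹' {w | c < gUpper x y w}) := by
        refine measure_mono_ae ?_
        filter_upwards [Measure.quasiMeasurePreserving_fst.ae hae₁,
          Measure.quasiMeasurePreserving_snd.ae hae₂] with p hp₁ hp₂ hc
        refine lt_of_lt_of_le (show c < Ψ (p.1.1, p.2.1) from hc) ?_
        change Ψ (p.1.1, p.2.1) ≤ gUpper x y (p.1.2, p.2.2)
        rw [gUpper_eq_one_sub x y hp₁.2.1 hp₂.2.1]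
        refine sub_le_sub_left ?_ 1
        -- Only strictly misordered atoms are lost for `X ≤ Y`, whereas `g` drops every pair with `y
        -- k ≤ x j`; the two agree in the absence of ties.
        have hties : ∀ j k, (if y k ≤ x j then (1 : ℝ) else 0) = if y k < x j then 1 else 0 :=
          fun j k => if_congr ⟨fun h => h.lt_of_ne (no_ties j k).symm, le_of_lt⟩ rfl rfl
        simp_rw [hties]
        rw [sum_fiberwise_image x y (fun j => p.1.2 j.succ) (fun k => p.2.2 k.succ)
          fun a b => if b < a then 1 else 0]
        refine Finset.sum_le_sum fun a _ => Finset.sum_le_sum fun b _ => ?_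
        refine mul_le_mul_of_nonneg_right ?_ (by split_ifs <;> norm_num)
        have hv : 0 ≤ ∑ k with y k = b, p.2.2 (Fin.succ k) :=
          Finset.sum_nonneg fun k _ => hp₂.1 _
        have hw : 0 ≤ ∑ j with x j = a, p.1.2 (Fin.succ j) :=
          Finset.sum_nonneg fun j _ => hp₁.1 _
        exact mul_le_mul (hp₁.2.2 a) (hp₂.2.2 b) hv (hw.trans (hp₁.2.2 a))
    _ = _ := by
        have hg : MeasurableSet {w | c < gUpper x y w} :=
          measurableSet_lt measurable_const (measurable_gUpper x y)
        rw [← Measure.map_apply (measurable_snd.prodMap measurable_snd) hg,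
          ← Measure.map_prod_map _ _ measurable_snd measurable_snd, hsnd₁, hsnd₂]

end UpperBound

/-! ### Attainment by degenerate base measures -/

section Attainment

variable {n : ℕ}

open Classical in
/-- The measure `∑ i, w i δ_{z i}` for `w` in the simplex, and a point mass otherwise. -/
noncomputable def discreteMeasure (p : (Fin n → ℝ) × (Fin n → ℝ)) : Measure ℝ :=
  if (∀ i, 0 ≤ p.2 i) ∧ ∑ i, p.2 i = 1 then
    ∑ i, ENNReal.ofReal (p.2 i) • Measure.dirac (p.1 i) else Measure.dirac 0

instance isProbabilityMeasure_discreteMeasure (p : (Fin n → ℝ) × (Fin n → ℝ)) :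
    IsProbabilityMeasure (discreteMeasure p) := by
  unfold discreteMeasure
  split_ifs with h
  · refine ⟨?_⟩
    simp only [Measure.finsetSum_apply, Measure.smul_apply, measure_univ, smul_eq_mul, mul_one]
    rw [← ENNReal.ofReal_sum_of_nonneg fun i _ => h.1 i, h.2, ENNReal.ofReal_one]
  · infer_instance

lemma measurable_discreteMeasure :
    Measurable (discreteMeasure : (Fin n → ℝ) × (Fin n → ℝ) → Measure ℝ) := by
  have hS : MeasurableSet {p : (Fin n → ℝ) × (Fin n → ℝ) |
      (∀ i, 0 ≤ p.2 i) ∧ ∑ i, p.2 i = 1} := by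
    simp only [Set.ofPred_and, Set.ofPred_forall]
    exact (MeasurableSet.iInter fun j => measurableSet_le (by fun_prop) (by fun_prop)).inter
      (measurableSet_eq_fun (by fun_prop) (by fun_prop))
  refine Measurable.ite hS (Measure.measurable_of_measurable_coe _ fun s hs => ?_) measurable_const
  simp only [Measure.finsetSum_apply, Measure.smul_apply, smul_eq_mul]
  refine Finset.measurable_sum _ fun i _ => Measurable.mul (by fun_prop) ?_
  exact (Measure.measurable_coe hs).comp (Measure.measurable_dirac.comp (by fun_prop))

/-- `discreteMeasure` as a probability measure. -/
noncomputable def discreteProba (p : (Fin n → ℝ) × (Fin n → ℝ)) : ProbabilityMeasure ℝ :=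
  ⟨discreteMeasure p, inferInstance⟩

lemma measurable_discreteProba :
    Measurable (discreteProba : (Fin n → ℝ) × (Fin n → ℝ) → ProbabilityMeasure ℝ) :=
  measurable_discreteMeasure.subtype_mk

lemma measurable_discreteProba_right (z : Fin n → ℝ) :
    Measurable fun w => discreteProba (z, w) :=
  measurable_discreteProba.comp measurable_prodMk_left

lemma coe_discreteProba {z w : Fin n → ℝ} (hw : (∀ i, 0 ≤ w i) ∧ ∑ i, w i = 1) :
    (discreteProba (z, w) : Measure ℝ) = ∑ i, ENNReal.ofReal (w i) • Measure.dirac (z i) :=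
  if_pos hw

lemma discreteProba_const {w : Fin n → ℝ} (hw : (∀ i, 0 ≤ w i) ∧ ∑ i, w i = 1) (c : ℝ) :
    discreteProba (fun _ => c, w) = diracProba c := by
  refine Subtype.ext ((coe_discreteProba hw).trans ?_)
  rw [← Finset.sum_smul, ← ENNReal.ofReal_sum_of_nonneg fun i _ => hw.1 i, hw.2,
    ENNReal.ofReal_one, one_smul]
  rfl

lemma real_sum_smul_dirac {w : Fin n → ℝ} (hw : ∀ i, 0 ≤ w i) (z : Fin n → ℝ) {s : Set ℝ}
    [DecidablePred (· ∈ s)] (hs : MeasurableSet s) :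
    (∑ i, ENNReal.ofReal (w i) • Measure.dirac (z i) : Measure ℝ).real s =
      ∑ i with z i ∈ s, w i := by
  rw [measureReal_def, Measure.finsetSum_apply, ENNReal.toReal_sum, Finset.sum_filter]
  · refine Finset.sum_congr rfl fun i _ => ?_
    rw [Measure.smul_apply, Measure.dirac_apply' _ hs, smul_eq_mul, ENNReal.toReal_mul,
      ENNReal.toReal_ofReal (hw i), Set.indicator_apply]
    split_ifs <;> simp
  · intro i _
    rw [Measure.smul_apply, smul_eq_mul]
    exact ENNReal.mul_ne_top ENNReal.ofReal_ne_top (measure_ne_top _ _)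

/-- The law of the random discrete measure with atoms `z i` and Dirichlet weights. -/
noncomputable def discreteDirichlet (a z : Fin n → ℝ) :
    ProbabilityMeasure (ProbabilityMeasure ℝ) :=
  ⟨(dirichletLaw a).map fun w => discreteProba (z, w),
    Measure.isProbabilityMeasure_map (measurable_discreteProba_right z).aemeasurable⟩

/-- Each atom lies in exactly one cell of a partition, so the cell masses are fibre sums of the
weights and aggregation applies. -/
lemma isDirichletProcess_discreteDirichlet {a : Fin n → ℝ} (ha : ∀ i, 0 ≤ a i) {i₀ : Fin n}
    (hi₀ : 0 < a i₀) (z : Fin n → ℝ) :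
    IsDirichletProcess (∑ i, ENNReal.ofReal (a i) • Measure.dirac (z i))
      (discreteDirichlet a z) := by
  classical
  intro m B hB hd hU
  have hloc : ∀ i, ∃ k, z i ∈ B k := fun i => Set.mem_iUnion.1 (hU ▸ Set.mem_univ (z i))
  choose f hf using hloc
  have hfB : ∀ i k, z i ∈ B k ↔ f i = k := fun i k =>
    ⟨fun h => by_contra fun hne => (Set.disjoint_left.1 (hd hne)) (hf i) h, fun h => h ▸ hf i⟩
  have hbase : (fun k => (∑ i, ENNReal.ofReal (a i) • Measure.dirac (z i) : Measure ℝ).real (B k)) =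
      fun k => ∑ i with f i = k, a i := by
    ext k
    simp only [real_sum_smul_dirac ha z (hB k), hfB]
  rw [hbase, ← map_fiberSum_dirichletLaw ha f]
  change Measure.map _ (Measure.map _ _) = _
  rw [Measure.map_map (measurable_pi_lambda _ fun k => measurable_real_apply (hB k))
    (measurable_discreteProba_right z)]
  refine Measure.map_congr ?_
  filter_upwards [ae_dirichletLaw_mem_simplex hi₀] with w hw
  ext k
  simp only [Function.comp_apply, coe_discreteProba hw, real_sum_smul_dirac hw.1 z (hB k), hfB]

lemma coe_discreteDirichlet_const {a : Fin n → ℝ} {i₀ : Fin n} (hi₀ : 0 < a i₀) (c : ℝ) :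
    (discreteDirichlet a fun _ => c : Measure (ProbabilityMeasure ℝ)) =
      Measure.dirac (diracProba c) := by
  have h : (fun w => discreteProba (fun _ => c, w)) =ᵐ[dirichletLaw a] fun _ => diracProba c := by
    filter_upwards [ae_dirichletLaw_mem_simplex hi₀] with w hw
    exact discreteProba_const hw c
  refine (Measure.map_congr h).trans ?_
  rw [Measure.map_const, measure_univ, one_smul]

/-- The posterior law of a Dirichlet process with a degenerate base measure. -/
noncomputable def discretePosterior (s c : ℝ) (n : ℕ) :
    Kernel (Fin n → ℝ) (ProbabilityMeasure ℝ) :=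
  (Kernel.id ×ₖ Kernel.const (Fin n → ℝ) (weightLaw s n)).map
    fun p => discreteProba ((Fin.cons c p.1 : Fin (n + 1) → ℝ), p.2)

lemma measurable_discreteProba_cons (c : ℝ) :
    Measurable fun p : (Fin n → ℝ) × (Fin (n + 1) → ℝ) =>
      discreteProba ((Fin.cons c p.1 : Fin (n + 1) → ℝ), p.2) := by
  refine measurable_discreteProba.comp (Measurable.prodMk ?_ measurable_snd)
  refine measurable_pi_lambda _ fun i => ?_
  induction i using Fin.cases with
  | zero => exact measurable_const
  | succ i => exact (measurable_pi_apply i).comp measurable_fst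

instance isMarkovKernel_discretePosterior (s c : ℝ) (n : ℕ) :
    IsMarkovKernel (discretePosterior s c n) :=
  Kernel.IsMarkovKernel.map _ (measurable_discreteProba_cons c)

lemma discretePosterior_apply (s c : ℝ) (z : Fin n → ℝ) :
    discretePosterior s c n z =
      discreteDirichlet (Fin.cons s fun _ : Fin n => 1) (Fin.cons c z) := by
  rw [discretePosterior, Kernel.map_apply _ (measurable_discreteProba_cons c), Kernel.prod_apply,
    Kernel.id_apply, Kernel.const_apply, Measure.dirac_prod,
    Measure.map_map (measurable_discreteProba_cons c) measurable_prodMk_left]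
  rfl

lemma updatedBase_diracProba (s c : ℝ) (z : Fin n → ℝ) :
    updatedBase s (diracProba c) z =
      ∑ i, ENNReal.ofReal ((Fin.cons s fun _ : Fin n => 1 : Fin (n + 1) → ℝ) i) •
        Measure.dirac ((Fin.cons c z : Fin (n + 1) → ℝ) i) := by
  simp [updatedBase, priorBase, Fin.sum_univ_succ, diracProba]

lemma isDirichletProcess_updatedBase_diracProba {s : ℝ} (hs : 0 < s) (c : ℝ) (z : Fin n → ℝ) :
    IsDirichletProcess (updatedBase s (diracProba c) z)
      (discreteDirichlet (Fin.cons s fun _ : Fin n => 1) (Fin.cons c z)) := by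
  rw [updatedBase_diracProba]
  exact isDirichletProcess_discreteDirichlet (weightParam_nonneg hs.le n) (i₀ := 0)
    (by simpa using hs) _

lemma coe_discreteDirichlet_cons_const {s : ℝ} (hs : 0 < s) (c : ℝ) (n : ℕ) :
    (discreteDirichlet (Fin.cons s fun _ : Fin n => 1) (Fin.cons c fun _ => c) :
      Measure (ProbabilityMeasure ℝ)) = Measure.dirac (diracProba c) := by
  have h : (Fin.cons c fun _ => c : Fin (n + 1) → ℝ) = fun _ => c := by
    ext i
    induction i using Fin.cases <;> simp
  rw [h]
  exact coe_discreteDirichlet_const (i₀ := 0) (by simpa using hs) c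

lemma isDirichletProcess_priorBase_diracProba {s : ℝ} (hs : 0 < s) (c : ℝ) :
    IsDirichletProcess (priorBase s (diracProba c))
      (discreteDirichlet (Fin.cons s fun _ : Fin 0 => 1) (Fin.cons c fun _ => c)) := by
  have h := isDirichletProcess_updatedBase_diracProba hs c fun _ : Fin 0 => c
  simpa [updatedBase] using h

lemma iidSample_diracProba (n : ℕ) (c : ℝ) :
    iidSample n (diracProba c) = Measure.dirac fun _ => c := by
  change Measure.pi (fun _ : Fin n => Measure.dirac c) = _
  refine Measure.pi_eq fun s hs => ?_
  rw [Measure.dirac_apply' _ (MeasurableSet.univ_pi hs)]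
  simp only [Measure.dirac_apply' _ (hs _)]
  by_cases h : (fun _ => c) ∈ Set.univ.pi s
  · rw [Set.indicator_of_mem h, Finset.prod_eq_one]
    · rfl
    · intro i _
      rw [Set.indicator_of_mem (h i trivial), Pi.one_apply]
  · rw [Set.indicator_of_notMem h]
    simp only [Set.mem_univ_pi, not_forall] at h
    obtain ⟨i, hi⟩ := h
    rw [Finset.prod_eq_zero (Finset.mem_univ i) (Set.indicator_of_notMem hi _)]

lemma dirac_compProd_eq_map {α β : Type*} [MeasurableSpace α] [MeasurableSpace β] (a : α)
    (κ : Kernel α β) [IsMarkovKernel κ] :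
    Measure.dirac a ⊗ₘ κ = (κ a).map (Prod.mk a) := by
  ext s hs
  rw [Measure.compProd_apply hs, lintegral_dirac' _ (Kernel.measurable_kernel_prodMk_left hs),
    Measure.map_apply measurable_prodMk_left hs]

/-- Under point-mass bases both priors, and hence the data, are deterministic, so Bayes' identity is
one between Dirac measures: at constant data the kernel returns the same degenerate laws. The values
at all other data sets are governed by the prescribed version. -/
lemma isPosterior_discretePosterior {s : ℝ} (hs : 0 < s) (c₁ c₂ : ℝ) (n₁ n₂ : ℕ) :
    IsPosterior s (diracProba c₁) (diracProba c₂)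
      (discretePosterior s c₁ n₁ ∥ₖ discretePosterior s c₂ n₂) where
  bayes := by
    refine ⟨_, _, isDirichletProcess_priorBase_diracProba hs c₁,
      isDirichletProcess_priorBase_diracProba hs c₂, ?_⟩
    have : IsMarkovKernel (twoSamples n₁ n₂) :=
      inferInstanceAs (IsMarkovKernel (iidSample n₁ ∥ₖ iidSample n₂))
    have hdata : twoSamples n₁ n₂ (diracProba c₁, diracProba c₂) =
        Measure.dirac (fun _ => c₁, fun _ => c₂) := by
      rw [twoSamples, Kernel.parallelComp_apply, iidSample_diracProba, iidSample_diracProba,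
        Measure.dirac_prod_dirac]
    rw [coe_discreteDirichlet_cons_const hs, coe_discreteDirichlet_cons_const hs,
      Measure.dirac_prod_dirac, dirac_compProd_eq_map, Measure.dirac_bind (Kernel.measurable _),
      hdata, dirac_compProd_eq_map, Kernel.parallelComp_apply, discretePosterior_apply,
      discretePosterior_apply, coe_discreteDirichlet_cons_const hs,
      coe_discreteDirichlet_cons_const hs, Measure.dirac_prod_dirac,
      Measure.map_dirac' measurable_prodMk_left, Measure.map_dirac' measurable_swap,
      Measure.map_dirac' measurable_prodMk_left]
    rfl
  version := fun x y => ⟨_, _, isDirichletProcess_updatedBase_diracProba hs c₁ x,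
    isDirichletProcess_updatedBase_diracProba hs c₂ y, by
      rw [Kernel.parallelComp_apply, discretePosterior_apply, discretePosterior_apply]⟩

lemma probLE_discreteProba {n₁ n₂ : ℕ} {z₁ w₁ : Fin n₁ → ℝ} {z₂ w₂ : Fin n₂ → ℝ}
    (h₁ : (∀ i, 0 ≤ w₁ i) ∧ ∑ i, w₁ i = 1) (h₂ : (∀ i, 0 ≤ w₂ i) ∧ ∑ i, w₂ i = 1) :
    probLE (discreteProba (z₁, w₁)) (discreteProba (z₂, w₂)) =
      ∑ j, ∑ k, w₁ j * w₂ k * (if z₁ j ≤ z₂ k then 1 else 0) := by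
  have hS : MeasurableSet {p : ℝ × ℝ | p.1 ≤ p.2} :=
    measurableSet_le measurable_fst measurable_snd
  rw [probLE, measureReal_def, Measure.prod_apply hS, coe_discreteProba h₁, coe_discreteProba h₂]
  have hmeas : ∀ a : ℝ, MeasurableSet (Prod.mk a ⁻¹' {p : ℝ × ℝ | p.1 ≤ p.2}) := fun a =>
    measurable_prodMk_left hS
  have hdirac : ∀ a k, Measure.dirac (z₂ k) (Prod.mk a ⁻¹' {p : ℝ × ℝ | p.1 ≤ p.2}) =
      if a ≤ z₂ k then 1 else 0 := by
    classical
    intro a k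
    rw [Measure.dirac_apply' _ (hmeas a), Set.indicator_apply]
    rfl
  simp only [lintegral_finsetSum_measure, lintegral_smul_measure, Measure.finsetSum_apply,
    Measure.smul_apply, smul_eq_mul, hdirac, lintegral_dirac]
  rw [ENNReal.toReal_sum]
  · refine Finset.sum_congr rfl fun j _ => ?_
    rw [ENNReal.toReal_mul, ENNReal.toReal_sum, ENNReal.toReal_ofReal (h₁.1 j), Finset.mul_sum]
    · refine Finset.sum_congr rfl fun k _ => ?_
      rw [ENNReal.toReal_mul, ENNReal.toReal_ofReal (h₂.1 k), mul_assoc]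
      split_ifs <;> simp
    · intro k _
      split_ifs <;> simp
  · intro j _
    refine ENNReal.mul_ne_top ENNReal.ofReal_ne_top (ENNReal.sum_ne_top.2 fun k _ => ?_)
    split_ifs <;> simp

/-- If the prior guess puts `X` below and `Y` above all the data, then `P(X ≤ Y)` has a posteriori
the law of `gUpper`. -/
lemma posterior_extreme_ge {s : ℝ} (hs : 0 < s) {n₁ n₂ : ℕ} {x : Fin n₁ → ℝ} {y : Fin n₂ → ℝ}
    (no_ties : ∀ i j, x i ≠ y j) {c₁ c₂ : ℝ} (hc : c₁ ≤ c₂) (h₁ : ∀ k, c₁ ≤ y k)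
    (h₂ : ∀ j, x j ≤ c₂) (c : ℝ) :
    ((weightLaw s n₁).prod (weightLaw s n₂)) {w | c < gUpper x y w} ≤
      (discretePosterior s c₁ n₁ ∥ₖ discretePosterior s c₂ n₂) (x, y)
        {F | c < probLE F.1 F.2} := by
  rw [Kernel.parallelComp_apply, discretePosterior_apply, discretePosterior_apply]
  change _ ≤ ((Measure.map _ (weightLaw s n₁)).prod (Measure.map _ (weightLaw s n₂))) _
  rw [Measure.map_prod_map _ _ (measurable_discreteProba_right _)
    (measurable_discreteProba_right _)]
  -- The inequality `Measure.le_map_apply` holds for arbitrary sets, so measurability of `probLE` is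
  -- not needed.
  refine le_trans (measure_mono_ae ?_) (Measure.le_map_apply
    ((measurable_discreteProba_right _).prodMap (measurable_discreteProba_right _)).aemeasurable _)
  filter_upwards [Measure.quasiMeasurePreserving_fst.ae (ae_weightLaw_mem_simplex hs n₁),
    Measure.quasiMeasurePreserving_snd.ae (ae_weightLaw_mem_simplex hs n₂)] with w hw₁ hw₂ hcw
  have hle : ∀ j k, x j ≤ y k ↔ x j < y k := fun j k =>
    ⟨fun h => h.lt_of_ne (no_ties j k), le_of_lt⟩
  have hg : gUpper x y w = probLE (discreteProba (Fin.cons c₁ x, w.1))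
      (discreteProba (Fin.cons c₂ y, w.2)) := by
    rw [probLE_discreteProba hw₁ hw₂, gUpper_eq_bilinear, bilinear_eq_sum]
    simp only [Fin.sum_univ_succ, augmentedMatrix, Matrix.of_apply, Fin.cons_zero, Fin.cons_succ,
      hc, h₁, h₂, hle, if_true]
    simp only [mul_comm]
  exact lt_of_lt_of_eq (show c < gUpper x y w from hcw) hg

end Attainment

theorem corollary1 (s : ℝ) (hs : 0 < s) (n₁ n₂ : ℕ) (x : Fin n₁ → ℝ) (y : Fin n₂ → ℝ)
    (no_ties : ∀ i j, x i ≠ y j) :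
    (∀ c ∈ Set.Icc (0 : ℝ) 1,
      upperPosteriorProb s x y c =
        ((weightLaw s n₁).prod (weightLaw s n₂)) {w | c < gUpper x y w}) ∧
    ((∀ j, MemLp (fun w => w j) 2 (weightLaw s n₁)) ∧
      (∀ k, MemLp (fun w => w k) 2 (weightLaw s n₂)) ∧
      MemLp (gUpper x y) 2 ((weightLaw s n₁).prod (weightLaw s n₂))) ∧
    ∫ w, gUpper x y w ∂((weightLaw s n₁).prod (weightLaw s n₂)) =
      meanVector (weightLaw s n₁) ⬝ᵥ
        (augmentedMatrix x y *ᵥ meanVector (weightLaw s n₂)) ∧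
    variance (gUpper x y) ((weightLaw s n₁).prod (weightLaw s n₂)) =
      Matrix.trace ((augmentedMatrix x y)ᵀ * secondMoment (weightLaw s n₁) *
        augmentedMatrix x y * secondMoment (weightLaw s n₂)) -
      (meanVector (weightLaw s n₁) ⬝ᵥ
        (augmentedMatrix x y *ᵥ meanVector (weightLaw s n₂))) ^ 2 ∧
    secondMoment (weightLaw s n₁) = weightSecondMoment s n₁ ∧
    secondMoment (weightLaw s n₂) = weightSecondMoment s n₂ := by
  refine ⟨fun c _ => le_antisymm (sSup_le ?_) ?_, ⟨memLp_weight hs n₁, memLp_weight hs n₂,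
    memLp_gUpper x y hs⟩, integral_gUpper x y hs, variance_gUpper x y hs,
    secondMoment_weightLaw hs n₁, secondMoment_weightLaw hs n₂⟩
  · rintro _ ⟨G₁, G₂, κ, hκ, rfl⟩
    obtain ⟨ν₁, ν₂, h₁, h₂, hν⟩ := hκ.version x y
    rw [hν]
    exact posterior_probLE_le hs no_ties h₁ h₂ c
  · obtain ⟨l, hl⟩ := (Set.finite_range y).bddBelow
    obtain ⟨u, hu⟩ := (Set.finite_range x).bddAbove
    -- Here `l` bounds the data of `Y` below and `u` those of `X` above; the minimum and maximum
    -- also force the first base atom to lie at or below the second.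
    refine le_trans (posterior_extreme_ge hs no_ties (c₁ := min l u) (c₂ := max l u)
      min_le_max (fun k => (min_le_left l u).trans (hl ⟨k, rfl⟩))
      (fun j => (hu ⟨j, rfl⟩).trans (le_max_right l u)) c) (le_sSup ?_)
    exact ⟨_, _, _, isPosterior_discretePosterior hs _ _ n₁ n₂, rfl⟩
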